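/- Let $S\subset\mathbb R^n_+=[0,\infty)^n$ be compact and convex with $0\in S$. For $m\in\mathbb N$ let $\mathcal P^S_m(\mathbb C^n)$ be the set of polynomials $p(z)=\sum_{\alpha\in (mS)\cap\mathbb N^n}a_\alpha z^\alpha$, and let $\mathcal P^S(\mathbb C^n)=\bigcup_{m\in\mathbb N}\mathcal P^S_m(\mathbb C^n)$. For $K\subset\mathbb C^n$ put $\|p\|_K=\sup_{w\in K}|p(w)|\in[0,\infty]$; the $S$-hull of $K$ is $$\widehat K^S=\{z\in\mathbb C^n : |p(z)|\le \|p\|_K\text{ for all }p\in\mathcal P^S(\mathbb C^n)\}.$$ Write $\mathbb C^{*n}=(\mathbb C\setminus\{0\})^n$. Assume that $S$ has empty interior in $\mathbb R^n$. (1) Assume in addition that $\overline{S\cap\mathbb Q^n}=S$, and let $\ell=\dim\operatorname{span}_{\mathbb R}S$. Then $\ell<n$. There is a linear map $L\colon\mathbb R^\ell\to\mathbb R^n$ such that (a) $S\subset L(\mathbb R^\ell)$ and $L(\mathbb Z^\ell)=(\operatorname{span}_{\mathbb R}S)\cap\mathbb Z^n$, and $L$ can moreover be chosen with $L^{-1}(S)\subset\mathbb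 R^\ell_+$. There are also (b) vectors $\beta'_1,\dots,\beta'_{n-\ell}\in\mathbb Z^n$ that generate the lattice $\{\beta\in\mathbb Z^n:\langle\beta,s\rangle=0\text{ for all }s\in S\}$. For any $L$ as in (a) and any $\beta'_1,\dots,\beta'_{n-\ell}$ as in (b), define $F_L\colon\mathbb C^{*n}\to\mathbb C^{*\ell}$ by $F_L(z)=(z^{L(e_1)},\dots,z^{L(e_\ell)})$, put $\beta_j=(\beta'_{1j},\dots,\beta'_{n-\ell,j})\in\mathbb Z^{n-\ell}$ for $j=1,\dots,n$, and for $z\in\mathbb C^{*n}$ define $\Upsilon_z\colon\mathbb C^{*(n-\ell)}\to\mathbb C^{*n}$ by $\Upsilon_z(t)=(z_1t^{\beta_1},\dots,z_nt^{\beta_n})$. Then for every $z\in\mathbb C^{*n}$ $$\widehat{\{z\}}{}^S\cap\mathbb C^{*n}=F_L^{-1}(F_L(z))=\Upsilon_z[\mathbb C^{*(n-\ell)}].$$ (2) For every $K\subset\mathbb C^n$ that intersects $\mathbb C^{*n}$, the $S$-hull $\widehat K^S$ is unbounded. -/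

import Mathlib

open scoped Pointwise ENNReal

noncomputable section

namespace SHull

/-- The lattice `ℤⁿ` as a subset of `ℝⁿ`. -/
def integerPoints (n : ℕ) : Set (Fin n → ℝ) :=
  {x | ∀ j, ∃ a : ℤ, x j = (a : ℝ)}

/-- `ℚⁿ` as a subset of `ℝⁿ`. -/
def rationalPoints (n : ℕ) : Set (Fin n → ℝ) :=
  {x | ∀ j, ∃ q : ℚ, x j = (q : ℝ)}

/-- The closed orthant `ℝⁿ₊`, that is `(ℝ₊)ⁿ`. -/
def orthant (n : ℕ) : Set (Fin n → ℝ) :=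
  {x | ∀ j, 0 ≤ x j}

/-- The torus `(ℂ*)ⁿ` as a subset of `ℂⁿ`. -/
def torus (n : ℕ) : Set (Fin n → ℂ) :=
  {z | ∀ j, z j ≠ 0}

variable {n : ℕ}

/-- The space `𝒫ₘˢ(ℂⁿ)` of all polynomials whose exponents lie in `(mS) ∩ ℕⁿ`. -/
def polySpace (S : Set (Fin n → ℝ)) (m : ℕ) : Set (MvPolynomial (Fin n) ℂ) :=
  {p | ∀ α ∈ p.support, (fun j => (α j : ℝ)) ∈ (m : ℝ) • S}

/-- `𝒫ˢ(ℂⁿ)`, the union of the spaces `𝒫ₘˢ(ℂⁿ)` over `m ∈ ℕ`. -/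
def polyRing (S : Set (Fin n → ℝ)) : Set (MvPolynomial (Fin n) ℂ) :=
  ⋃ m : ℕ, polySpace S m

/-- The supremum `‖p‖_K` of `|p|` over `K`, with value `∞` if `p` is unbounded on `K`. -/
def supNorm (K : Set (Fin n → ℂ)) (p : MvPolynomial (Fin n) ℂ) : ℝ≥0∞ :=
  ⨆ w ∈ K, ‖MvPolynomial.eval w p‖ₑ

/-- The `S`-hull of `K`: all `z ∈ ℂⁿ` with `|p(z)| ≤ ‖p‖_K` for every `p ∈ 𝒫ˢ(ℂⁿ)`. -/
def hull (S : Set (Fin n → ℝ)) (K : Set (Fin n → ℂ)) : Set (Fin n → ℂ) :=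
  {z | ∀ p ∈ polyRing S, ‖MvPolynomial.eval z p‖ₑ ≤ supNorm K p}

/-- `L : ℝ^ℓ → ℝⁿ` is a linear map whose image contains `S`, where `ℓ` is the dimension of `S`
(of its linear span, as `0 ∈ S`), and which maps `ℤ^ℓ` onto the lattice points of `span S`. -/
structure IsLatticeParam (S : Set (Fin n → ℝ)) {ℓ : ℕ}
    (L : (Fin ℓ → ℝ) →ₗ[ℝ] (Fin n → ℝ)) : Prop where
  dim_eq : ℓ = Module.finrank ℝ (Submodule.span ℝ S)
  subset_range : S ⊆ Set.range L
  map_lattice : L '' integerPoints ℓ = (Submodule.span ℝ S : Set (Fin n → ℝ)) ∩ integerPoints n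

/-- The Laurent monomial `z^α = z₁^α₁ ⋯ zₙ^αₙ` with integer exponents. -/
def laurentMonomial (z : Fin n → ℂ) (α : Fin n → ℤ) : ℂ :=
  ∏ j, z j ^ α j

/-- `F_L(z) = (z^{L(e₁)}, …, z^{L(e_ℓ)})`. It is used for `L` mapping `ℤ^ℓ` into `ℤⁿ` only; then
the coordinates of `L(e_k)` are integers and the floor just reads them as such. -/
def monomialMap {ℓ : ℕ} (L : (Fin ℓ → ℝ) →ₗ[ℝ] (Fin n → ℝ)) (z : Fin n → ℂ) : Fin ℓ → ℂ :=
  fun k => laurentMonomial z (fun j => ⌊L (Pi.single k 1) j⌋)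

/-- The fiber in `(ℂ*)ⁿ` of `F_L : (ℂ*)ⁿ → (ℂ*)^ℓ` over `F_L(z)`. -/
def monomialFiber {ℓ : ℕ} (L : (Fin ℓ → ℝ) →ₗ[ℝ] (Fin n → ℝ)) (z : Fin n → ℂ) :
    Set (Fin n → ℂ) :=
  {w | w ∈ torus n ∧ monomialMap L w = monomialMap L z}

/-- The lattice of integer vectors that are orthogonal to `S`, or what is the same, to `span S`. -/
def orthogonalLattice (S : Set (Fin n → ℝ)) : Submodule ℤ (Fin n → ℤ) where
  carrier := {b | ∀ s ∈ S, ∑ j, (b j : ℝ) * s j = 0}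
  zero_mem' := by
    intro s _
    simp
  add_mem' := by
    intro a b ha hb s hs
    simp only [Pi.add_apply, Int.cast_add, add_mul, Finset.sum_add_distrib]
    rw [ha s hs, hb s hs, add_zero]
  smul_mem' := by
    intro c b hb s hs
    simp only [Pi.smul_apply, smul_eq_mul, Int.cast_mul, mul_assoc]
    rw [← Finset.mul_sum, hb s hs, mul_zero]

/-- `Υ_z(t) = (z₁ t^{β₁}, …, zₙ t^{βₙ})` where `β₁, …, βₙ` are the vectors dual to the family
`b = (β'₁, …, β'_d)` of vectors in `ℤⁿ`, that is `(β_j)_k = (β'_k)_j`. -/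
def fiberParam {d : ℕ} (b : Fin d → Fin n → ℤ) (z : Fin n → ℂ) (t : Fin d → ℂ) : Fin n → ℂ :=
  fun j => z j * laurentMonomial t (fun k => b k j)

end SHull

end

/-! Everything reduces to the lattice M of integer points of `span S`. A polynomial in `polyRing S`
has all exponents in M, so its value on the torus depends only on the Laurent monomials with
exponents in M. Conversely, if α lies in a dilate of S, then z^α minus its value at a point is an
admissible polynomial, so z^α is constant on the hull of that point. Since rational points are dense
in S, they span `span S`, and every element of M is a difference of such α
(`exists_sub_of_mem_spanLattice`). So in the torus the hull of {z} is given by w^a = z^a for all a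
in M, which is the fiber of F_L because the L(e_k) generate M.

For the parametrization, u = w/z gives a character of ℤⁿ that is trivial on M. By density M is the
double orthogonal of itself (`mem_spanLattice_of_orthogonal`), so the character factors through the
map a ↦ (⟨β'_k, a⟩)_k. As ℂ* is divisible, it extends to a character of ℤ^d, and that is the
required t.

Choosing L with L⁻¹(S) in the orthant means shearing a basis of M far enough
(`exists_basis_nonneg`). For unboundedness, a real vector ξ ≠ 0 orthogonal to S gives a curve (z_i
exp(τ ξ_i)) on which every admissible polynomial is constant. -/

namespace SHull

variable {n : ℕ}

/-! ### Integer points of the span of S -/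

/-- The inclusion `ℤⁿ → ℝⁿ`. -/
def castVec (n : ℕ) : (Fin n → ℤ) →ₗ[ℤ] (Fin n → ℝ) :=
  (Int.castAddHom ℝ).toIntLinearMap.compLeft (Fin n)

@[simp]
theorem castVec_apply (a : Fin n → ℤ) (j : Fin n) : castVec n a j = (a j : ℝ) := rfl

theorem castVec_injective : Function.Injective (castVec n) := by
  intro a b h
  ext j
  simpa using congrFun h j

theorem castVec_mem_integerPoints (a : Fin n → ℤ) : castVec n a ∈ integerPoints n :=
  fun j => ⟨a j, rfl⟩

theorem exists_castVec_eq {x : Fin n → ℝ} (hx : x ∈ integerPoints n) : ∃ a, castVec n a = x := by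
  choose a ha using hx
  exact ⟨a, funext fun j => (ha j).symm⟩

theorem linearIndependent_castVec {κ : Type*} {v : κ → Fin n → ℤ} (hv : LinearIndependent ℤ v) :
    LinearIndependent ℝ (fun i => castVec n (v i)) :=
  (linearIndependent_algebraMap_comp_iff (R := ℤ) (S := ℝ)).mpr hv

/-- The lattice of integer points of the real span of `S`. -/
def spanLattice (S : Set (Fin n → ℝ)) : Submodule ℤ (Fin n → ℤ) :=
  ((Submodule.span ℝ S).restrictScalars ℤ).comap (castVec n)

theorem mem_spanLattice {S : Set (Fin n → ℝ)} {a : Fin n → ℤ} :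
    a ∈ spanLattice S ↔ castVec n a ∈ Submodule.span ℝ S := Iff.rfl

theorem castVec_image_spanLattice (S : Set (Fin n → ℝ)) :
    castVec n '' (spanLattice S : Set (Fin n → ℤ)) =
      (Submodule.span ℝ S : Set (Fin n → ℝ)) ∩ integerPoints n := by
  ext x
  constructor
  · rintro ⟨a, ha, rfl⟩
    exact ⟨ha, castVec_mem_integerPoints a⟩
  · rintro ⟨hx, hi⟩
    obtain ⟨a, rfl⟩ := exists_castVec_eq hi
    exact ⟨a, hx, rfl⟩

theorem exists_common_denominator {m : ℕ} (q : Fin m → ℚ) :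
    ∃ D : ℕ, 0 < D ∧ ∃ a : Fin m → ℤ, ∀ j, (D : ℚ) * q j = (a j : ℚ) := by
  refine ⟨∏ j, (q j).den, Finset.prod_pos fun j _ => (q j).pos, ?_⟩
  have h : ∀ j, ∃ a : ℤ, ((∏ i, (q i).den : ℕ) : ℚ) * q j = (a : ℚ) := by
    intro j
    obtain ⟨k, hk⟩ := Finset.dvd_prod_of_mem (fun i => (q i).den) (Finset.mem_univ j)
    refine ⟨k * (q j).num, ?_⟩
    rw [hk]
    push_cast
    rw [mul_right_comm, Rat.den_mul_eq_num]
    ring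
  choose a ha using h
  exact ⟨a, ha⟩

theorem exists_nat_smul_eq_castVec {x : Fin n → ℝ} (hx : x ∈ rationalPoints n) :
    ∃ D : ℕ, 0 < D ∧ ∃ a, (D : ℝ) • x = castVec n a := by
  choose q hq using hx
  obtain ⟨D, hD, a, ha⟩ := exists_common_denominator q
  refine ⟨D, hD, a, funext fun j => ?_⟩
  have := ha j
  simp only [Pi.smul_apply, smul_eq_mul, hq j, castVec_apply]
  exact_mod_cast this

/-- Finite-dimensional subspaces are closed, so the span of a dense part of S already contains S. -/
theorem span_inter_rationalPoints {S : Set (Fin n → ℝ)}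
    (hS : closure (S ∩ rationalPoints n) = S) :
    Submodule.span ℝ (S ∩ rationalPoints n) = Submodule.span ℝ S := by
  refine le_antisymm (Submodule.span_mono Set.inter_subset_left) (Submodule.span_le.mpr ?_)
  have hc := Submodule.closed_of_finiteDimensional (Submodule.span ℝ (S ∩ rationalPoints n))
  calc S = closure (S ∩ rationalPoints n) := hS.symm
    _ ⊆ _ := closure_minimal Submodule.subset_span hc

theorem span_castVec_image_spanLattice {S : Set (Fin n → ℝ)}
    (hS : closure (S ∩ rationalPoints n) = S) :
    Submodule.span ℝ (castVec n '' (spanLattice S : Set (Fin n → ℤ))) = Submodule.span ℝ S := by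
  refine le_antisymm (Submodule.span_le.mpr ?_) ?_
  · rintro _ ⟨a, ha, rfl⟩
    exact ha
  rw [← span_inter_rationalPoints hS]
  refine Submodule.span_le.mpr ?_
  rintro x ⟨hxS, hx⟩
  obtain ⟨D, hD, a, ha⟩ := exists_nat_smul_eq_castVec hx
  have hD' : (D : ℝ) ≠ 0 := by positivity
  have hx' : x = (D : ℝ)⁻¹ • castVec n a := by rw [← ha, inv_smul_smul₀ hD']
  rw [hx']
  refine Submodule.smul_mem _ _ (Submodule.subset_span ⟨a, ?_, rfl⟩)
  change castVec n a ∈ Submodule.span ℝ S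
  rw [← ha]
  exact Submodule.smul_mem _ _ (Submodule.subset_span hxS)

theorem span_range_castVec_basis {S : Set (Fin n → ℝ)}
    (hS : closure (S ∩ rationalPoints n) = S) {κ : Type*} (B : Module.Basis κ ℤ (spanLattice S)) :
    Submodule.span ℝ (Set.range fun k => castVec n (B k)) = Submodule.span ℝ S := by
  rw [← span_castVec_image_spanLattice hS]
  refine le_antisymm (Submodule.span_mono ?_) (Submodule.span_le.mpr ?_)
  · rintro _ ⟨k, rfl⟩
    exact ⟨B k, (B k).2, rfl⟩
  · rintro _ ⟨a, ha, rfl⟩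
    have h : (⟨a, ha⟩ : spanLattice S) ∈ Submodule.span ℤ (Set.range B) := by
      rw [B.span_eq]; trivial
    have h2 := Submodule.mem_map_of_mem (f := (castVec n).comp (spanLattice S).subtype) h
    rw [Submodule.map_span, ← Set.range_comp] at h2
    exact Submodule.span_le_restrictScalars ℤ ℝ _ h2

theorem linearIndependent_castVec_basis {S : Set (Fin n → ℝ)} {κ : Type*}
    (B : Module.Basis κ ℤ (spanLattice S)) :
    LinearIndependent ℝ (fun k => castVec n (B k)) :=
  linearIndependent_castVec
    (B.linearIndependent.map' (spanLattice S).subtype (Submodule.ker_subtype _))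

theorem finrank_spanLattice {S : Set (Fin n → ℝ)}
    (hS : closure (S ∩ rationalPoints n) = S) :
    Module.finrank ℤ (spanLattice S) = Module.finrank ℝ (Submodule.span ℝ S) := by
  have B := Module.finBasis ℤ (spanLattice S)
  rw [← span_range_castVec_basis hS B, finrank_span_eq_card (linearIndependent_castVec_basis B),
    Fintype.card_fin]

/-- A convex set whose affine span is everything has interior points, and since 0 ∈ S the affine
span is the linear span. -/
theorem span_ne_top {S : Set (Fin n → ℝ)} (hconv : Convex ℝ S) (h0 : (0 : Fin n → ℝ) ∈ S)
    (hint : interior S = ∅) : Submodule.span ℝ S ≠ ⊤ := by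
  intro h
  have h1 : affineSpan ℝ S = ⊤ := by
    have h2 : insert 0 S = S := Set.insert_eq_of_mem h0
    apply SetLike.coe_injective
    rw [← h2, affineSpan_insert_zero, h]
    simp
  exact (hconv.interior_nonempty_iff_affineSpan_eq_top.mpr h1).ne_empty hint

theorem finrank_span_lt {S : Set (Fin n → ℝ)} (hconv : Convex ℝ S) (h0 : (0 : Fin n → ℝ) ∈ S)
    (hint : interior S = ∅) : Module.finrank ℝ (Submodule.span ℝ S) < n := by
  simpa using Submodule.finrank_lt (span_ne_top hconv h0 hint)

/-! ### Orthogonality and the dual lattice -/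

theorem orthogonal_span {S : Set (Fin n → ℝ)} {ξ : Fin n → ℝ} (h : ∀ s ∈ S, ξ ⬝ᵥ s = 0)
    {x : Fin n → ℝ} (hx : x ∈ Submodule.span ℝ S) : ξ ⬝ᵥ x = 0 := by
  induction hx using Submodule.span_induction with
  | mem x hx => exact h x hx
  | zero => simp
  | add x y _ _ hx hy => rw [dotProduct_add, hx, hy, add_zero]
  | smul c x _ hx => rw [dotProduct_smul, hx, smul_zero]

theorem exists_orthogonal_ne_zero {S : Set (Fin n → ℝ)} {x : Fin n → ℝ}
    (hx : x ∉ Submodule.span ℝ S) : ∃ ξ : Fin n → ℝ, ξ ⬝ᵥ x ≠ 0 ∧ ∀ s ∈ S, ξ ⬝ᵥ s = 0 := by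
  obtain ⟨f, hf, hk⟩ := Submodule.exists_le_ker_of_notMem hx
  have hf' : ∀ y, (fun j => f (Pi.single j 1)) ⬝ᵥ y = f y := by
    intro y
    conv_rhs => rw [pi_eq_sum_univ' y]
    simp [dotProduct, mul_comm]
  refine ⟨_, by rwa [hf'], fun s hs => ?_⟩
  rw [hf']
  exact hk (Submodule.subset_span hs)

theorem mem_orthogonalLattice {S : Set (Fin n → ℝ)} {b : Fin n → ℤ} :
    b ∈ orthogonalLattice S ↔ ∀ s ∈ S, castVec n b ⬝ᵥ s = 0 := Iff.rfl

/-- The real span of the orthogonal lattice meets `span S` only in vectors orthogonal to themselves,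
that is in 0. -/
theorem finrank_orthogonalLattice_le (S : Set (Fin n → ℝ)) :
    Module.finrank ℤ (orthogonalLattice S) ≤ n - Module.finrank ℝ (Submodule.span ℝ S) := by
  have B := Module.finBasis ℤ (orthogonalLattice S)
  have hli : LinearIndependent ℝ (fun k => castVec n (B k)) := linearIndependent_castVec
    (B.linearIndependent.map' (orthogonalLattice S).subtype (Submodule.ker_subtype _))
  set W := Submodule.span ℝ (Set.range fun k => castVec n (B k)) with hW
  have hcard : Module.finrank ℝ W = Module.finrank ℤ (orthogonalLattice S) := by
    rw [hW, finrank_span_eq_card hli, Fintype.card_fin]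
  have hdisj : Disjoint W (Submodule.span ℝ S) := by
    rw [Submodule.disjoint_def]
    intro x hxW hxS
    have h1 : ∀ y ∈ Submodule.span ℝ S, y ⬝ᵥ x = 0 := by
      intro y hy
      refine orthogonal_span (S := Set.range fun k => castVec n (B k)) ?_ hxW
      rintro _ ⟨k, rfl⟩
      rw [dotProduct_comm]
      exact orthogonal_span (mem_orthogonalLattice.mp (B k).2) hy
    exact dotProduct_self_eq_zero.mp (h1 x hxS)
  have := Submodule.finrank_add_finrank_le_of_disjoint hdisj
  rw [Module.finrank_fin_fun, hcard] at this
  omega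

theorem exists_generators_orthogonalLattice (S : Set (Fin n → ℝ)) :
    ∃ b : Fin (n - Module.finrank ℝ (Submodule.span ℝ S)) → Fin n → ℤ,
      Submodule.span ℤ (Set.range b) = orthogonalLattice S := by
  have hle := finrank_orthogonalLattice_le S
  have B := Module.finBasis ℤ (orthogonalLattice S)
  -- The rank is only known to be at most n - ℓ, so a basis is padded with zero vectors.
  refine ⟨fun k => if h : (k : ℕ) < Module.finrank ℤ (orthogonalLattice S) then B ⟨k, h⟩ else 0,
    le_antisymm (Submodule.span_le.mpr ?_) ?_⟩
  · rintro _ ⟨k, rfl⟩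
    dsimp only
    split_ifs
    · exact Subtype.coe_prop _
    · exact zero_mem _
  · have h : Submodule.span ℤ (Set.range fun k => (B k : Fin n → ℤ)) = orthogonalLattice S := by
      have := congrArg (Submodule.map (orthogonalLattice S).subtype) B.span_eq
      rw [Submodule.map_span, ← Set.range_comp, Submodule.map_subtype_top] at this
      exact this
    conv_lhs => rw [← h]
    refine Submodule.span_mono ?_
    rintro _ ⟨k, rfl⟩
    exact ⟨Fin.castLE hle k, by simp⟩

/-- A functional separating a from M is taken over ℚ rather than ℝ, so that clearing denominators
turns it into an integer vector b. It kills M, hence S by density. -/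
theorem mem_spanLattice_of_orthogonal {S : Set (Fin n → ℝ)}
    (hS : closure (S ∩ rationalPoints n) = S) {a : Fin n → ℤ}
    (ha : ∀ b ∈ orthogonalLattice S, b ⬝ᵥ a = 0) : a ∈ spanLattice S := by
  by_contra hna
  let toQ : (Fin n → ℤ) → (Fin n → ℚ) := fun a j => (a j : ℚ)
  have hQ : toQ a ∉ Submodule.span ℚ (toQ '' (spanLattice S : Set (Fin n → ℤ))) := by
    intro h
    let g : (Fin n → ℚ) →ₗ[ℚ] (Fin n → ℝ) := (Algebra.linearMap ℚ ℝ).compLeft (Fin n)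
    have h2 := Submodule.mem_map_of_mem (f := g) h
    rw [Submodule.map_span] at h2
    have h3 : g (toQ a) ∈ Submodule.span ℝ S := by
      have h4 := Submodule.span_le_restrictScalars ℚ ℝ _ h2
      refine Submodule.span_le.mpr ?_ h4
      rintro _ ⟨_, ⟨c, hc, rfl⟩, rfl⟩
      have : g (toQ c) = castVec n c := by ext j; simp [g, toQ]
      rw [this]
      exact hc
    have : g (toQ a) = castVec n a := by ext j; simp [g, toQ]
    rw [this] at h3
    exact hna h3
  obtain ⟨f, hf, hk⟩ := Submodule.exists_le_ker_of_notMem hQ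
  obtain ⟨D, hD, b, hb⟩ := exists_common_denominator fun j => f (Pi.single j 1)
  have hpair : ∀ c : Fin n → ℤ, ((b ⬝ᵥ c : ℤ) : ℚ) = D * f (toQ c) := by
    intro c
    conv_rhs => rw [pi_eq_sum_univ' (toQ c)]
    simp only [dotProduct, Int.cast_sum, Int.cast_mul, ← hb, map_sum, map_smul, Finset.mul_sum,
      smul_eq_mul]
    refine Finset.sum_congr rfl fun j _ => ?_
    simp only [toQ]
    ring
  have hbS : b ∈ orthogonalLattice S := by
    rw [mem_orthogonalLattice]
    intro s hs
    have hs' : s ∈ Submodule.span ℝ (castVec n '' (spanLattice S : Set (Fin n → ℤ))) := by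
      rw [span_castVec_image_spanLattice hS]
      exact Submodule.subset_span hs
    refine orthogonal_span ?_ hs'
    rintro _ ⟨c, hc, rfl⟩
    have h0 : b ⬝ᵥ c = 0 := by
      have h1 : f (toQ c) = 0 := hk (Submodule.subset_span ⟨c, hc, rfl⟩)
      have := hpair c
      rw [h1, mul_zero] at this
      exact_mod_cast this
    have := congrArg (Int.cast : ℤ → ℝ) h0
    simpa [dotProduct] using this
  have := hpair a
  rw [ha b hbS, Int.cast_zero] at this
  have hD' : (D : ℚ) ≠ 0 := by positivity
  exact mul_ne_zero hD' hf this.symm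

/-! ### Laurent monomials -/

theorem laurentMonomial_ne_zero {z : Fin n → ℂ} (hz : z ∈ torus n) (a : Fin n → ℤ) :
    laurentMonomial z a ≠ 0 :=
  Finset.prod_ne_zero_iff.mpr fun j _ => zpow_ne_zero _ (hz j)

@[simp]
theorem laurentMonomial_zero (z : Fin n → ℂ) : laurentMonomial z 0 = 1 := by
  simp [laurentMonomial]

theorem laurentMonomial_add {z : Fin n → ℂ} (hz : z ∈ torus n) (a b : Fin n → ℤ) :
    laurentMonomial z (a + b) = laurentMonomial z a * laurentMonomial z b := by
  simp only [laurentMonomial, Pi.add_apply, ← Finset.prod_mul_distrib]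
  exact Finset.prod_congr rfl fun j _ => zpow_add₀ (hz j) _ _

theorem laurentMonomial_smul (z : Fin n → ℂ) (c : ℤ) (a : Fin n → ℤ) :
    laurentMonomial z (c • a) = laurentMonomial z a ^ c := by
  simp only [laurentMonomial, ← Finset.prod_zpow, ← zpow_mul, Pi.smul_apply, smul_eq_mul,
    mul_comm c]

theorem laurentMonomial_eq_of_mem_span {w z : Fin n → ℂ} (hw : w ∈ torus n) (hz : z ∈ torus n)
    {A : Set (Fin n → ℤ)} (h : ∀ a ∈ A, laurentMonomial w a = laurentMonomial z a)
    {a : Fin n → ℤ} (ha : a ∈ Submodule.span ℤ A) : laurentMonomial w a = laurentMonomial z a := by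
  induction ha using Submodule.span_induction with
  | mem x hx => exact h x hx
  | zero => simp
  | add x y _ _ hx hy => rw [laurentMonomial_add hw, laurentMonomial_add hz, hx, hy]
  | smul c x _ hx => rw [laurentMonomial_smul, laurentMonomial_smul, hx]

theorem laurentMonomial_mul (z w : Fin n → ℂ) (a : Fin n → ℤ) :
    laurentMonomial (z * w) a = laurentMonomial z a * laurentMonomial w a := by
  simp [laurentMonomial, mul_zpow, Finset.prod_mul_distrib]

theorem laurentMonomial_laurentMonomial {d : ℕ} {t : Fin d → ℂ} (ht : t ∈ torus d)
    (b : Fin d → Fin n → ℤ) (a : Fin n → ℤ) :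
    laurentMonomial (fun j => laurentMonomial t fun k => b k j) a =
      laurentMonomial t fun k => b k ⬝ᵥ a := by
  simp only [laurentMonomial, dotProduct, ← Finset.prod_zpow]
  rw [Finset.prod_comm]
  refine Finset.prod_congr rfl fun k _ => ?_
  have : ∀ s : Finset (Fin n), ∏ j ∈ s, (t k ^ b k j) ^ a j = t k ^ ∑ j ∈ s, b k j * a j := by
    intro s
    induction s using Finset.cons_induction with
    | empty => simp
    | cons j s hj ih => rw [Finset.prod_cons, Finset.sum_cons, zpow_add₀ (ht k), ih, zpow_mul]
  exact this _

/-- Roots of every order exist in ℂ*, so it is divisible and thus an injective ℤ-module; this lets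
characters extend from sublattices. -/
theorem baer_additive_units_complex : Module.Baer ℤ (Additive ℂˣ) := by
  have key : ∀ (x : Additive ℂˣ) {m : ℤ}, m ≠ 0 → ∃ y : Additive ℂˣ, m • y = x := by
    have hnat : ∀ (x : ℂˣ) {m : ℕ}, m ≠ 0 → ∃ y : ℂˣ, y ^ m = x := by
      intro x m hm
      obtain ⟨y, hy⟩ := IsAlgClosed.exists_pow_nat_eq (x : ℂ) (Nat.pos_of_ne_zero hm)
      have hy0 : y ≠ 0 := by
        rintro rfl
        rw [zero_pow hm] at hy
        exact x.ne_zero hy.symm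
      exact ⟨Units.mk0 y hy0, Units.ext (by simpa using hy)⟩
    intro x m hm
    obtain ⟨k, rfl | rfl⟩ := m.eq_nat_or_neg
    · obtain ⟨y, hy⟩ := hnat x.toMul (m := k) (by simpa using hm)
      exact ⟨Additive.ofMul y, by rw [natCast_zsmul, ← ofMul_pow, hy]; rfl⟩
    · obtain ⟨y, hy⟩ := hnat x.toMul (m := k) (by simpa using hm)
      refine ⟨-Additive.ofMul y, ?_⟩
      rw [neg_smul_neg, natCast_zsmul, ← ofMul_pow, hy]; rfl
  let : DivisibleBy (Additive ℂˣ) ℤ :=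
    { div := fun x m => if h : m = 0 then 0 else (key x h).choose
      div_zero := fun x => by simp
      div_cancel := fun {m} x h => by
        simpa only [h, dite_false] using (key x h).choose_spec }
  exact Module.Baer.of_divisible _

theorem exists_torus_of_laurentMonomial {d : ℕ} {b : Fin d → Fin n → ℤ} {u : Fin n → ℂ}
    (hu : u ∈ torus n)
    (h : ∀ a : Fin n → ℤ, (∀ k, b k ⬝ᵥ a = 0) → laurentMonomial u a = 1) :
    ∃ t ∈ torus d, ∀ j, laurentMonomial t (fun k => b k j) = u j := by
  let B : (Fin n → ℤ) →ₗ[ℤ] (Fin d → ℤ) := Matrix.mulVecLin (Matrix.of b)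
  let χ : (Fin n → ℤ) →ₗ[ℤ] Additive ℂˣ :=
    Fintype.linearCombination ℤ fun j => Additive.ofMul (Units.mk0 (u j) (hu j))
  have hχ : ∀ a, (((χ a).toMul : ℂˣ) : ℂ) = laurentMonomial u a := by
    intro a
    simp [χ, Fintype.linearCombination_apply, laurentMonomial]
  have hker : LinearMap.ker B ≤ LinearMap.ker χ := by
    intro a ha
    have h1 := h a fun k => congrFun (LinearMap.mem_ker.mp ha) k
    rw [← hχ] at h1
    rw [LinearMap.mem_ker]
    exact Additive.toMul.injective (Units.ext h1)
  -- The character of u, descended to the image of B; it is then extended to all of ℤ^d as τ.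
  let g : LinearMap.range B →ₗ[ℤ] Additive ℂˣ :=
    ((LinearMap.ker B).liftQ χ hker).comp B.quotKerEquivRange.symm.toLinearMap
  obtain ⟨τ, hτ⟩ := baer_additive_units_complex.extension_property
    (LinearMap.range B).subtype Subtype.val_injective g
  have hτB : ∀ a, τ (B a) = χ a := by
    intro a
    have h1 := LinearMap.congr_fun hτ ⟨B a, LinearMap.mem_range_self B a⟩
    simp only [LinearMap.comp_apply, Submodule.subtype_apply] at h1
    rw [h1]
    have h2 : B.quotKerEquivRange.symm ⟨B a, LinearMap.mem_range_self B a⟩ =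
        (LinearMap.ker B).mkQ a := by
      rw [LinearEquiv.symm_apply_eq]
      rfl
    simp only [g, LinearMap.comp_apply, LinearEquiv.coe_coe, h2, Submodule.mkQ_apply,
      Submodule.liftQ_apply]
  -- A character of ℤ^d is determined by its values on the standard basis, and these are the
  -- coordinates of t.
  refine ⟨fun k => ((τ (Pi.single k 1)).toMul : ℂˣ), fun k => Units.ne_zero _, fun j => ?_⟩
  have h1 : τ (fun k => b k j) = χ (Pi.single j 1) := by
    rw [← hτB]
    congr 1
    ext k
    simp [B]
  have h2 : (((χ (Pi.single j 1)).toMul : ℂˣ) : ℂ) = u j := by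
    simp [χ]
  rw [← h2, ← h1]
  conv_rhs => rw [pi_eq_sum_univ' fun k => b k j]
  simp only [laurentMonomial, map_sum, map_smul, toMul_sum, toMul_zsmul, Units.coe_prod,
    Units.val_zpow_eq_zpow_val]

/-! ### Fibers -/

theorem IsLatticeParam.exists_basis_image {S : Set (Fin n → ℝ)} {ℓ : ℕ}
    {L : (Fin ℓ → ℝ) →ₗ[ℝ] (Fin n → ℝ)} (hL : IsLatticeParam S L) :
    ∃ a : Fin ℓ → Fin n → ℤ, (∀ k, L (Pi.single k 1) = castVec n (a k)) ∧
      Submodule.span ℤ (Set.range a) = spanLattice S := by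
  have hmap := hL.map_lattice
  rw [← castVec_image_spanLattice] at hmap
  have h1 : ∀ k : Fin ℓ, ∃ a ∈ spanLattice S, castVec n a = L (Pi.single k 1) := by
    intro k
    have : L (Pi.single k 1) ∈ L '' integerPoints ℓ := by
      refine ⟨_, fun j => ⟨(Pi.single k 1 : Fin ℓ → ℤ) j, ?_⟩, rfl⟩
      by_cases h : j = k
      · subst h; simp
      · simp [h]
    rw [hmap] at this
    exact this
  choose a ha hLa using h1
  refine ⟨a, fun k => (hLa k).symm, le_antisymm (Submodule.span_le.mpr ?_) fun c hc => ?_⟩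
  · rintro _ ⟨k, rfl⟩
    exact ha k
  · have : castVec n c ∈ L '' integerPoints ℓ := by
      rw [hmap]
      exact ⟨c, hc, rfl⟩
    obtain ⟨x, hx, hxc⟩ := this
    obtain ⟨x, rfl⟩ := exists_castVec_eq hx
    have h2 : c = ∑ k, x k • a k := by
      apply castVec_injective
      rw [← hxc, pi_eq_sum_univ' (castVec ℓ x), map_sum, map_sum]
      refine Finset.sum_congr rfl fun k _ => ?_
      rw [map_smul, map_smul, ← hLa, castVec_apply, Int.cast_smul_eq_zsmul]
    rw [h2]
    exact Submodule.sum_mem _ fun k _ => Submodule.smul_mem _ _ (Submodule.subset_span ⟨k, rfl⟩)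

/-- The vectors L(e_k) generate M, so the fiber depends on S and z alone, not on L. -/
theorem mem_monomialFiber_iff {S : Set (Fin n → ℝ)} {ℓ : ℕ}
    {L : (Fin ℓ → ℝ) →ₗ[ℝ] (Fin n → ℝ)} (hL : IsLatticeParam S L) {z w : Fin n → ℂ}
    (hz : z ∈ torus n) :
    w ∈ monomialFiber L z ↔
      w ∈ torus n ∧ ∀ a ∈ spanLattice S, laurentMonomial w a = laurentMonomial z a := by
  obtain ⟨a, hLa, hspan⟩ := hL.exists_basis_image
  have hfloor : ∀ (y : Fin n → ℂ) (k : Fin ℓ), monomialMap L y k = laurentMonomial y (a k) := by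
    intro y k
    simp [monomialMap, hLa]
  constructor
  · rintro ⟨hw, h⟩
    refine ⟨hw, fun c hc => ?_⟩
    rw [← hspan] at hc
    refine laurentMonomial_eq_of_mem_span hw hz ?_ hc
    rintro _ ⟨k, rfl⟩
    rw [← hfloor, ← hfloor, h]
  · rintro ⟨hw, h⟩
    refine ⟨hw, funext fun k => ?_⟩
    rw [hfloor, hfloor]
    exact h _ (hspan ▸ Submodule.subset_span ⟨k, rfl⟩)

theorem dotProduct_eq_zero_of_mem_lattices {S : Set (Fin n → ℝ)} {a b : Fin n → ℤ}
    (ha : a ∈ spanLattice S) (hb : b ∈ orthogonalLattice S) : b ⬝ᵥ a = 0 := by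
  have h : castVec n b ⬝ᵥ castVec n a = 0 := orthogonal_span (mem_orthogonalLattice.mp hb) ha
  simp only [dotProduct, castVec_apply] at h ⊢
  exact_mod_cast h

theorem monomialFiber_eq_image_fiberParam {S : Set (Fin n → ℝ)}
    (hS : closure (S ∩ rationalPoints n) = S) {ℓ : ℕ}
    {L : (Fin ℓ → ℝ) →ₗ[ℝ] (Fin n → ℝ)} (hL : IsLatticeParam S L) {d : ℕ}
    {b : Fin d → Fin n → ℤ} (hb : Submodule.span ℤ (Set.range b) = orthogonalLattice S)
    {z : Fin n → ℂ} (hz : z ∈ torus n) :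
    monomialFiber L z = fiberParam b z '' torus d := by
  ext w
  rw [mem_monomialFiber_iff hL hz]
  constructor
  · rintro ⟨hw, h⟩
    have hu : (fun j => (z j)⁻¹ * w j) ∈ torus n :=
      fun j => mul_ne_zero (inv_ne_zero (hz j)) (hw j)
    have hw' : w = z * fun j => (z j)⁻¹ * w j := by
      ext j
      simp [mul_inv_cancel_left₀ (hz j)]
    obtain ⟨t, ht, htu⟩ := exists_torus_of_laurentMonomial (b := b) hu (by
      intro a ha
      have haS : a ∈ spanLattice S := by
        refine mem_spanLattice_of_orthogonal hS fun c hc => ?_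
        rw [← hb] at hc
        induction hc using Submodule.span_induction with
        | mem x hx => obtain ⟨k, rfl⟩ := hx; exact ha k
        | zero => simp
        | add x y _ _ hx hy => rw [add_dotProduct, hx, hy, add_zero]
        | smul c x _ hx => rw [smul_dotProduct, hx, smul_zero]
      have h1 := h a haS
      rw [hw', laurentMonomial_mul] at h1
      exact mul_left_cancel₀ (laurentMonomial_ne_zero hz a) (h1.trans (mul_one _).symm))
    refine ⟨t, ht, funext fun j => ?_⟩
    rw [fiberParam, htu, mul_inv_cancel_left₀ (hz j)]
  · rintro ⟨t, ht, rfl⟩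
    refine ⟨fun j => mul_ne_zero (hz j) (laurentMonomial_ne_zero ht _), fun a ha => ?_⟩
    have h1 : fiberParam b z t = z * fun j => laurentMonomial t fun k => b k j := rfl
    have h2 : (fun k => b k ⬝ᵥ a) = 0 := funext fun k =>
      dotProduct_eq_zero_of_mem_lattices ha (hb ▸ Submodule.subset_span ⟨k, rfl⟩)
    rw [h1, laurentMonomial_mul, laurentMonomial_laurentMonomial ht, h2, laurentMonomial_zero,
      mul_one]

/-! ### Hulls -/

theorem exists_mem_smul_add {S : Set (Fin n → ℝ)} (hconv : Convex ℝ S) {x y : Fin n → ℝ}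
    (hx : ∃ m : ℕ, x ∈ (m : ℝ) • S) (hy : ∃ m : ℕ, y ∈ (m : ℝ) • S) :
    ∃ m : ℕ, x + y ∈ (m : ℝ) • S := by
  obtain ⟨k, hx⟩ := hx
  obtain ⟨m, hy⟩ := hy
  refine ⟨k + m, ?_⟩
  rw [Nat.cast_add, hconv.add_smul k.cast_nonneg m.cast_nonneg]
  exact Set.add_mem_add hx hy

/-- Natural dilates of S exhaust the convex cone over S: as 0 ∈ S, a coefficient may be rounded up
to an integer k, and dilates add by convexity. -/
theorem exists_mem_smul_sum {S : Set (Fin n → ℝ)} (hconv : Convex ℝ S)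
    (h0 : (0 : Fin n → ℝ) ∈ S) {κ : Type*} [Fintype κ] {c : κ → ℝ} (hc : ∀ i, 0 ≤ c i)
    {s : κ → Fin n → ℝ} (hs : ∀ i, s i ∈ S) : ∃ m : ℕ, ∑ i, c i • s i ∈ (m : ℝ) • S := by
  refine Finset.sum_induction (fun i => c i • s i) (fun x => ∃ m : ℕ, x ∈ (m : ℝ) • S)
    (fun _ _ => exists_mem_smul_add hconv) ⟨0, ?_⟩ fun i _ => ?_
  · exact ⟨0, h0, smul_zero _⟩
  obtain ⟨k, hk⟩ := exists_nat_gt (c i)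
  have hk0 : (0 : ℝ) < k := (hc i).trans_lt hk
  refine ⟨k, (c i / k) • s i, ?_, ?_⟩
  · exact hconv.smul_mem_of_zero_mem h0 (hs i)
      ⟨div_nonneg (hc i) hk0.le, (div_le_one hk0).mpr hk.le⟩
  · change (k : ℝ) • (c i / k) • s i = _
    rw [smul_smul, mul_div_cancel₀ _ hk0.ne']

/-- Every integer point of `span S` is a difference of integer points in dilates of `S`. -/
theorem exists_sub_of_mem_spanLattice {S : Set (Fin n → ℝ)} (hconv : Convex ℝ S)
    (h0 : (0 : Fin n → ℝ) ∈ S) (hS : closure (S ∩ rationalPoints n) = S) {a : Fin n → ℤ}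
    (ha : a ∈ spanLattice S) :
    ∃ c : Fin n → ℤ, (∃ m : ℕ, castVec n c ∈ (m : ℝ) • S) ∧
      ∃ m : ℕ, castVec n (a + c) ∈ (m : ℝ) • S := by
  rw [mem_spanLattice, ← span_inter_rationalPoints hS, Submodule.mem_span_set'] at ha
  obtain ⟨r, f, g, hfg⟩ := ha
  have hg : ∀ i, ∃ D : ℕ, 0 < D ∧ ∃ e, (D : ℝ) • (g i : Fin n → ℝ) = castVec n e :=
    fun i => exists_nat_smul_eq_castVec (g i).2.2
  choose D hD e he using hg
  -- The shift c = N ∑ D_i g_i, with D_i g_i integral, makes every coefficient f_i + N D_i of a + c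
  -- nonnegative.
  obtain ⟨N, hN⟩ := exists_nat_gt (∑ i, |f i|)
  have hsum : castVec n (∑ i, (N : ℤ) • e i) = ∑ i, ((N : ℝ) * D i) • (g i : Fin n → ℝ) := by
    rw [map_sum]
    refine Finset.sum_congr rfl fun i _ => ?_
    rw [map_smul, ← he, mul_smul, natCast_zsmul, Nat.cast_smul_eq_nsmul ℝ N]
  refine ⟨∑ i, (N : ℤ) • e i, ?_, ?_⟩
  · rw [hsum]
    exact exists_mem_smul_sum hconv h0 (fun i => by positivity) fun i => (g i).2.1
  · rw [map_add, hsum, ← hfg, ← Finset.sum_add_distrib]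
    simp only [← add_smul]
    refine exists_mem_smul_sum hconv h0 (fun i => ?_) fun i => (g i).2.1
    have h1 : |f i| ≤ ∑ i, |f i| :=
      Finset.single_le_sum (fun i _ => abs_nonneg (f i)) (Finset.mem_univ i)
    have h2 : (1 : ℝ) ≤ D i := by exact_mod_cast hD i
    have h3 : (N : ℝ) ≤ N * D i := le_mul_of_one_le_right N.cast_nonneg h2
    have h4 := neg_abs_le (f i)
    linarith

theorem supNorm_singleton (z : Fin n → ℂ) (p : MvPolynomial (Fin n) ℂ) :
    supNorm {z} p = ‖MvPolynomial.eval z p‖ₑ := by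
  simp [supNorm]

/-- Monomials with exponents in a dilate of `S` are constant on the hull of a point. -/
theorem prod_pow_eq_of_mem_hull {S : Set (Fin n → ℝ)} (h0 : (0 : Fin n → ℝ) ∈ S)
    {z w : Fin n → ℂ} (hw : w ∈ hull S {z}) {α : Fin n →₀ ℕ} {m : ℕ}
    (hα : (fun j => (α j : ℝ)) ∈ (m : ℝ) • S) : ∏ j, w j ^ α j = ∏ j, z j ^ α j := by
  classical
  -- This p vanishes at z, hence on the hull of {z}. Its constant term is admissible because 0 ∈ S.
  set p : MvPolynomial (Fin n) ℂ :=
    MvPolynomial.monomial α 1 - MvPolynomial.C (∏ j, z j ^ α j) with hp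
  have heval : ∀ y : Fin n → ℂ, MvPolynomial.eval y p = ∏ j, y j ^ α j - ∏ j, z j ^ α j := by
    intro y
    rw [hp, map_sub, MvPolynomial.eval_C, MvPolynomial.eval_monomial, one_mul,
      Finsupp.prod_fintype _ _ fun _ => pow_zero _]
  have hmem : p ∈ polyRing S := by
    refine Set.mem_iUnion.mpr ⟨m, fun β hβ => ?_⟩
    rcases Finset.mem_union.mp (MvPolynomial.support_sub _ _ _ hβ) with h | h
    · rw [Finset.mem_singleton.mp (MvPolynomial.support_monomial_subset h)]
      exact hα
    · rw [Finset.mem_singleton.mp (MvPolynomial.support_monomial_subset h)]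
      exact ⟨0, h0, by ext; simp⟩
  have h := hw p hmem
  rw [supNorm_singleton, heval, heval, sub_self, enorm_zero, nonpos_iff_eq_zero,
    enorm_eq_zero] at h
  exact sub_eq_zero.mp h

theorem mem_span_of_mem_smul {S : Set (Fin n → ℝ)} {c : ℝ} {x : Fin n → ℝ} (hx : x ∈ c • S) :
    x ∈ Submodule.span ℝ S := by
  obtain ⟨s, hs, rfl⟩ := hx
  exact Submodule.smul_mem _ _ (Submodule.subset_span hs)

theorem eval_eq_of_mem_polyRing {S : Set (Fin n → ℝ)} {p : MvPolynomial (Fin n) ℂ}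
    (hp : p ∈ polyRing S) {z w : Fin n → ℂ}
    (h : ∀ α : Fin n →₀ ℕ, (fun j => (α j : ℝ)) ∈ Submodule.span ℝ S →
      ∏ j, w j ^ α j = ∏ j, z j ^ α j) : MvPolynomial.eval w p = MvPolynomial.eval z p := by
  obtain ⟨m, hm⟩ := Set.mem_iUnion.mp hp
  rw [MvPolynomial.eval_eq', MvPolynomial.eval_eq']
  refine Finset.sum_congr rfl fun α hα => ?_
  rw [h α (mem_span_of_mem_smul (hm α hα))]

theorem laurentMonomial_natCast (z : Fin n → ℂ) (α : Fin n → ℕ) :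
    laurentMonomial z (fun j => (α j : ℤ)) = ∏ j, z j ^ α j := by
  simp [laurentMonomial]

theorem laurentMonomial_eq_of_mem_hull {S : Set (Fin n → ℝ)} (hpos : S ⊆ orthant n)
    (h0 : (0 : Fin n → ℝ) ∈ S) {z w : Fin n → ℂ} (hw : w ∈ hull S {z}) {a : Fin n → ℤ} {m : ℕ}
    (ha : castVec n a ∈ (m : ℝ) • S) : laurentMonomial w a = laurentMonomial z a := by
  have hnn : ∀ j, ∃ k : ℕ, a j = k := by
    intro j
    obtain ⟨s, hs, hsa⟩ := ha
    refine Int.eq_ofNat_of_zero_le ?_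
    have h1 : (m : ℝ) * s j = a j := congrFun hsa j
    have h2 : (0 : ℝ) ≤ a j := h1 ▸ mul_nonneg m.cast_nonneg (hpos hs j)
    exact_mod_cast h2
  choose α hα using hnn
  obtain rfl : a = fun j => (α j : ℤ) := funext hα
  rw [laurentMonomial_natCast, laurentMonomial_natCast]
  refine prod_pow_eq_of_mem_hull h0 hw (α := Finsupp.equivFunOnFinite.symm α) (m := m) ?_
  convert ha using 1
  ext j
  simp

theorem hull_inter_torus_eq_monomialFiber {S : Set (Fin n → ℝ)} (hconv : Convex ℝ S)
    (hpos : S ⊆ orthant n) (h0 : (0 : Fin n → ℝ) ∈ S)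
    (hS : closure (S ∩ rationalPoints n) = S) {ℓ : ℕ}
    {L : (Fin ℓ → ℝ) →ₗ[ℝ] (Fin n → ℝ)} (hL : IsLatticeParam S L)
    {z : Fin n → ℂ} (hz : z ∈ torus n) :
    hull S {z} ∩ torus n = monomialFiber L z := by
  ext w
  rw [mem_monomialFiber_iff hL hz]
  constructor
  · rintro ⟨hwS, hw⟩
    refine ⟨hw, fun a ha => ?_⟩
    obtain ⟨c, ⟨m, hc⟩, k, hac⟩ := exists_sub_of_mem_spanLattice hconv h0 hS ha
    have h1 := laurentMonomial_eq_of_mem_hull hpos h0 hwS hc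
    have h2 := laurentMonomial_eq_of_mem_hull hpos h0 hwS hac
    rw [laurentMonomial_add hw, laurentMonomial_add hz, h1] at h2
    exact mul_right_cancel₀ (laurentMonomial_ne_zero hz c) h2
  · rintro ⟨hw, h⟩
    refine ⟨fun p hp => ?_, hw⟩
    rw [supNorm_singleton, eval_eq_of_mem_polyRing hp fun α hα => ?_]
    have := h (fun j => (α j : ℤ)) (by
      rw [mem_spanLattice]
      convert hα using 1
      ext j
      simp)
    rwa [laurentMonomial_natCast, laurentMonomial_natCast] at this

theorem not_isBounded_hull {S : Set (Fin n → ℝ)} (hspan : Submodule.span ℝ S ≠ ⊤)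
    {K : Set (Fin n → ℂ)} (hK : (K ∩ torus n).Nonempty) : ¬ Bornology.IsBounded (hull S K) := by
  obtain ⟨z, hzK, hz⟩ := hK
  obtain ⟨x, hx⟩ : ∃ x, x ∉ Submodule.span ℝ S := by
    by_contra! h
    exact hspan (Submodule.eq_top_iff'.mpr h)
  obtain ⟨ξ, hξx, hξ⟩ := exists_orthogonal_ne_zero hx
  obtain ⟨j, hj⟩ : ∃ j, ξ j ≠ 0 := by
    by_contra! h
    exact hξx (by simp [dotProduct, h])
  intro hb
  obtain ⟨C, hC⟩ := hb.exists_norm_le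
  let w : ℝ → Fin n → ℂ := fun τ i => z i * (Real.exp (τ * ξ i) : ℝ)
  have hw : ∀ τ, w τ ∈ hull S K := by
    intro τ p hp
    rw [eval_eq_of_mem_polyRing hp (z := z) fun α hα => ?_]
    · exact le_iSup₂_of_le z hzK le_rfl
    have h1 : ∑ i, ξ i * (α i : ℝ) = 0 := orthogonal_span hξ hα
    have h2 : ∏ i, Real.exp (τ * ξ i) ^ α i = 1 := by
      simp only [← Real.exp_nat_mul]
      rw [← Real.exp_sum, Real.exp_eq_one_iff, ← mul_zero τ, ← h1, Finset.mul_sum]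
      exact Finset.sum_congr rfl fun i _ => by ring
    simp only [w, mul_pow, Finset.prod_mul_distrib]
    rw [← mul_one (∏ i, z i ^ α i)]
    congr 1
    · simp
    · exact_mod_cast h2
  have hzj : 0 < ‖z j‖ := norm_pos_iff.mpr (hz j)
  -- At this τ the j-th coordinate has modulus |z_j| exp(C/|z_j|) ≥ C + |z_j| > C.
  have h1 := (norm_le_pi_norm _ j).trans (hC _ (hw (C / ‖z j‖ / ξ j)))
  simp only [w, norm_mul, Complex.norm_real, Real.norm_eq_abs, Real.abs_exp,
    div_mul_cancel₀ _ hj] at h1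
  have h2 := Real.add_one_le_exp (C / ‖z j‖)
  have h3 := mul_le_mul_of_nonneg_left h2 hzj.le
  rw [mul_add, mul_div_cancel₀ _ hzj.ne'] at h3
  linarith

/-! ### Lattice parametrizations -/

/-- The real linear map sending the standard basis to a family of integer vectors. -/
noncomputable def latticeMap {ℓ : ℕ} (a : Fin ℓ → Fin n → ℤ) : (Fin ℓ → ℝ) →ₗ[ℝ] (Fin n → ℝ) :=
  Fintype.linearCombination ℝ fun k => castVec n (a k)

theorem latticeMap_apply {ℓ : ℕ} (a : Fin ℓ → Fin n → ℤ) (x : Fin ℓ → ℝ) :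
    latticeMap a x = ∑ k, x k • castVec n (a k) :=
  Fintype.linearCombination_apply ..

theorem latticeMap_castVec {ℓ : ℕ} (a : Fin ℓ → Fin n → ℤ) (x : Fin ℓ → ℤ) :
    latticeMap a (castVec ℓ x) = castVec n (∑ k, x k • a k) := by
  simp only [latticeMap_apply, map_sum, map_smul, castVec_apply, Int.cast_smul_eq_zsmul]

theorem isLatticeParam_latticeMap {S : Set (Fin n → ℝ)}
    (hS : closure (S ∩ rationalPoints n) = S) {ℓ : ℕ}
    (B : Module.Basis (Fin ℓ) ℤ (spanLattice S)) :
    IsLatticeParam S (latticeMap fun k => (B k : Fin n → ℤ)) where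
  dim_eq := by
    rw [← finrank_spanLattice hS, Module.finrank_eq_card_basis B, Fintype.card_fin]
  subset_range := by
    have h : LinearMap.range (latticeMap fun k => (B k : Fin n → ℤ)) = Submodule.span ℝ S := by
      rw [latticeMap, Fintype.range_linearCombination, span_range_castVec_basis hS B]
    rw [← LinearMap.coe_range, h]
    exact Submodule.subset_span
  map_lattice := by
    rw [← castVec_image_spanLattice]
    ext x
    constructor
    · rintro ⟨y, hy, rfl⟩
      obtain ⟨y, rfl⟩ := exists_castVec_eq hy
      rw [latticeMap_castVec]
      exact ⟨_, Submodule.sum_mem _ fun k _ => Submodule.smul_mem _ _ (B k).2, rfl⟩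
    · rintro ⟨a, ha, rfl⟩
      refine ⟨castVec ℓ (B.repr ⟨a, ha⟩), castVec_mem_integerPoints _, ?_⟩
      rw [latticeMap_castVec]
      have := congrArg (spanLattice S).subtype (B.sum_repr ⟨a, ha⟩)
      rw [map_sum] at this
      exact congrArg (castVec n) this

/-! ### A lattice basis whose cone contains S -/

/-- The image of φ is a principal ideal of ℤ; a preimage v of its positive generator splits M as ℤv
⊕ ker φ. -/
theorem exists_pos_generator_values {M : Type*} [AddCommGroup M] {φ : M →ₗ[ℤ] ℤ} (hφ : φ ≠ 0) :
    ∃ v, 0 < φ v ∧ ∀ x, φ v ∣ φ x := by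
  obtain ⟨g, hg⟩ := IsPrincipalIdealRing.principal (LinearMap.range φ)
  have hdvd : ∀ x, g ∣ φ x := by
    intro x
    have : φ x ∈ LinearMap.range φ := LinearMap.mem_range_self φ x
    rw [hg] at this
    exact Ideal.mem_span_singleton.mp this
  obtain ⟨v, hv⟩ : g ∈ LinearMap.range φ := by
    rw [hg]
    exact Submodule.mem_span_singleton_self g
  have hg0 : g ≠ 0 := by
    rintro rfl
    exact hφ (LinearMap.ext fun x => zero_dvd_iff.mp (hdvd x))
  rcases lt_or_gt_of_ne hg0 with h | h
  · exact ⟨-v, by rw [map_neg, hv]; omega, fun x => by rw [map_neg, hv, neg_dvd]; exact hdvd x⟩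
  · exact ⟨v, hv ▸ h, fun x => hv ▸ hdvd x⟩

/-- The sum of the coordinates on the lattice of integer points of `span S`. -/
def coordSum (S : Set (Fin n → ℝ)) : spanLattice S →ₗ[ℤ] ℤ :=
  (∑ j, LinearMap.proj j) ∘ₗ (spanLattice S).subtype

theorem sum_castVec {S : Set (Fin n → ℝ)} (a : spanLattice S) :
    ∑ j, castVec n a j = (coordSum S a : ℝ) := by
  simp [coordSum]

theorem norm_le_sum_of_mem_orthant {s : Fin n → ℝ} (hs : s ∈ orthant n) : ‖s‖ ≤ ∑ j, s j := by
  refine (pi_norm_le_iff_of_nonneg (Finset.sum_nonneg fun j _ => hs j)).mpr fun j => ?_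
  rw [Real.norm_of_nonneg (hs j)]
  exact Finset.single_le_sum (fun i _ => hs i) (Finset.mem_univ j)

/-- The vanishing passes from the lattice to its real span, hence to S, and a vector of the orthant
with coordinate sum 0 is 0. -/
theorem span_eq_bot_of_coordSum_eq_zero {S : Set (Fin n → ℝ)} (hpos : S ⊆ orthant n)
    (hS : closure (S ∩ rationalPoints n) = S) (h : coordSum S = 0) :
    Submodule.span ℝ S = ⊥ := by
  rw [Submodule.span_eq_bot]
  intro s hs
  have h1 : (fun _ => (1 : ℝ)) ⬝ᵥ s = 0 := by
    have hs' := Submodule.subset_span (R := ℝ) hs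
    rw [← span_castVec_image_spanLattice hS] at hs'
    refine orthogonal_span ?_ hs'
    rintro _ ⟨a, ha, rfl⟩
    have := sum_castVec (S := S) ⟨a, ha⟩
    rw [h] at this
    simpa [dotProduct] using this
  have h2 := norm_le_sum_of_mem_orthant (hpos hs)
  simp only [dotProduct, one_mul] at h1
  rw [h1] at h2
  exact norm_le_zero_iff.mp h2

/-- On S the coordinate sum dominates the norm, so the coordinates along a basis e_i of its kernel
are bounded by a multiple of the coordinate along v. Replacing v by v - N ∑ e_i adds N times the
v-coordinate to each of them, which for large N makes them nonnegative. -/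
theorem exists_basis_nonneg {S : Set (Fin n → ℝ)} (hpos : S ⊆ orthant n)
    (hS : closure (S ∩ rationalPoints n) = S) :
    ∃ (ℓ : ℕ) (B : Module.Basis (Fin ℓ) ℤ (spanLattice S)),
      (latticeMap fun k => (B k : Fin n → ℤ)) ⁻¹' S ⊆ orthant ℓ := by
  by_cases hφ : coordSum S = 0
  · have hr : Module.finrank ℤ (spanLattice S) = 0 := by
      rw [finrank_spanLattice hS, span_eq_bot_of_coordSum_eq_zero hpos hS hφ, finrank_bot]
    exact ⟨0, Module.finBasisOfFinrankEq ℤ _ hr, fun x _ k => k.elim0⟩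
  obtain ⟨v, hv, hdvd⟩ := exists_pos_generator_values hφ
  set φ := coordSum S
  set k := Module.finrank ℤ (LinearMap.ker φ)
  let e := Module.finBasis ℤ (LinearMap.ker φ)
  let y : ℕ → spanLattice S := fun N => v - (N : ℤ) • ∑ i, (e i : spanLattice S)
  have he : ∀ i, φ (e i) = 0 := fun i => (e i).2
  have hy : ∀ N, φ (y N) = φ v := by
    intro N
    simp [y, map_sum, he]
  have hB : ∀ N, ∃ B : Module.Basis (Fin (k + 1)) ℤ (spanLattice S),
      (B : Fin (k + 1) → spanLattice S) = Fin.cons (y N) ((↑) ∘ e) := by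
    intro N
    refine ⟨Module.Basis.mkFinCons (y N) e ?_ ?_, Module.Basis.coe_mkFinCons _ _ _ _⟩
    · intro c x hx h
      have := congrArg φ h
      rw [map_add, map_smul, hy, LinearMap.mem_ker.mp hx, add_zero, map_zero, smul_eq_mul] at this
      exact (mul_eq_zero.mp this).resolve_right hv.ne'
    · intro z
      obtain ⟨c, hc⟩ := hdvd z
      refine ⟨-c, ?_⟩
      rw [LinearMap.mem_ker, map_add, map_smul, hy, hc, smul_eq_mul]
      ring
  choose B hB using hB
  have hmap : ∀ N x, latticeMap (fun k => (B N k : Fin n → ℤ)) x =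
      x 0 • castVec n (y N) + ∑ i : Fin k, x i.succ • castVec n (e i : spanLattice S) := by
    intro N x
    rw [latticeMap_apply, Fin.sum_univ_succ]
    simp [hB]
  have hinj : LinearMap.ker (latticeMap fun k => (B 0 k : Fin n → ℤ)) = ⊥ :=
    LinearMap.ker_eq_bot.mpr (linearIndependent_castVec_basis (B 0)).fintypeLinearCombination_injective
  obtain ⟨C, -, hC⟩ := LinearMap.exists_antilipschitzWith _ hinj
  -- C bounds the coordinates in the unsheared basis (N = 0) by the norm; φ v relates the first
  -- coordinate to the coordinate sum.
  obtain ⟨N, hN⟩ := exists_nat_ge ((C : ℝ) * φ v)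
  refine ⟨k + 1, B N, fun x hx => ?_⟩
  set s := latticeMap (fun k => (B N k : Fin n → ℤ)) x with hs
  have hsum : ∑ j, s j = φ v * x 0 := by
    rw [hs, hmap]
    simp only [Pi.add_apply, Finset.sum_apply, Pi.smul_apply, smul_eq_mul, Finset.sum_add_distrib]
    rw [Finset.sum_comm]
    simp only [← Finset.mul_sum, sum_castVec]
    change x 0 * (φ (y N) : ℝ) + ∑ i : Fin k, x i.succ * (φ (e i) : ℝ) = _
    simp [hy, he, mul_comm]
  have hv' : (0 : ℝ) < φ v := by exact_mod_cast hv
  have hsnorm := norm_le_sum_of_mem_orthant (hpos hx)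
  rw [hsum] at hsnorm
  have hx0 : 0 ≤ x 0 := nonneg_of_mul_nonneg_right ((norm_nonneg s).trans hsnorm) hv'
  -- The coordinates of s in the unsheared basis.
  let x' : Fin (k + 1) → ℝ := Fin.cons (x 0) fun i => x i.succ - N * x 0
  have hx' : latticeMap (fun k => (B 0 k : Fin n → ℤ)) x' = s := by
    rw [hs, hmap, hmap]
    simp only [x', y, Fin.cons_zero, Fin.cons_succ, sub_smul, Finset.sum_sub_distrib,
      Submodule.coe_sub, Submodule.coe_smul, map_sub, map_smul, smul_sub, Submodule.coe_sum,
      map_sum, Finset.smul_sum, mul_smul]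
    simp only [Nat.cast_zero, zero_smul, Finset.sum_const_zero, smul_zero, sub_zero,
      Nat.cast_smul_eq_nsmul, smul_comm N]
    abel
  have hbound : ‖x'‖ ≤ N * x 0 := by
    have h1 := hC.le_mul_dist x' 0
    rw [map_zero, dist_zero_right, dist_zero_right, hx'] at h1
    calc ‖x'‖ ≤ C * ‖s‖ := h1
      _ ≤ C * (φ v * x 0) := by gcongr
      _ = C * φ v * x 0 := by ring
      _ ≤ N * x 0 := by gcongr
  intro i
  refine Fin.cases hx0 (fun i => ?_) i
  have h1 := (norm_le_pi_norm x' i.succ).trans hbound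
  simp only [x', Fin.cons_succ, Real.norm_eq_abs] at h1
  have h2 := neg_le_of_abs_le h1
  linarith

end SHull

theorem proposition2p5 {n : ℕ} (S : Set (Fin n → ℝ))
    (hS_compact : IsCompact S) (hS_convex : Convex ℝ S)
    (hS_orthant : S ⊆ SHull.orthant n) (hS_zero : (0 : Fin n → ℝ) ∈ S)
    (hS_interior : interior S = ∅) :
    (closure (S ∩ SHull.rationalPoints n) = S →
      ∃ ℓ : ℕ, ℓ = Module.finrank ℝ (Submodule.span ℝ S) ∧ ℓ < n ∧
        (∃ L : (Fin ℓ → ℝ) →ₗ[ℝ] (Fin n → ℝ),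
          SHull.IsLatticeParam S L ∧ L ⁻¹' S ⊆ SHull.orthant ℓ) ∧
        (∃ b : Fin (n - ℓ) → Fin n → ℤ,
          Submodule.span ℤ (Set.range b) = SHull.orthogonalLattice S) ∧
        ∀ L : (Fin ℓ → ℝ) →ₗ[ℝ] (Fin n → ℝ), SHull.IsLatticeParam S L →
        ∀ b : Fin (n - ℓ) → Fin n → ℤ,
          Submodule.span ℤ (Set.range b) = SHull.orthogonalLattice S →
        ∀ z ∈ SHull.torus n,
          SHull.hull S {z} ∩ SHull.torus n = SHull.monomialFiber L z ∧
          SHull.monomialFiber L z = SHull.fiberParam b z '' SHull.torus (n - ℓ)) ∧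
    ∀ K : Set (Fin n → ℂ), (K ∩ SHull.torus n).Nonempty →
      ¬ Bornology.IsBounded (SHull.hull S K) := by
  refine ⟨fun hS => ?_, fun K hK =>
    SHull.not_isBounded_hull (SHull.span_ne_top hS_convex hS_zero hS_interior) hK⟩
  obtain ⟨ℓ, B, hB⟩ := SHull.exists_basis_nonneg hS_orthant hS
  have hL := SHull.isLatticeParam_latticeMap hS B
  -- Replacing ℓ by the dimension of the span matches the index type `Fin (n - ℓ)` of the
  -- generators.
  obtain rfl := hL.dim_eq
  exact ⟨_, rfl, SHull.finrank_span_lt hS_convex hS_zero hS_interior, ⟨_, hL, hB⟩,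
    SHull.exists_generators_orthogonalLattice S, fun L hL b hb z hz =>
      ⟨SHull.hull_inter_torus_eq_monomialFiber hS_convex hS_orthant hS_zero hS hL hz,
        SHull.monomialFiber_eq_image_fiberParam hS hL hb hz⟩⟩
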